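/- Let $R:\mathbb R\times\mathbb R^m\to\mathbb R^m$ be smooth, and suppose the ODE system $q'(t)=R(t,q(t))$ has $\ell$ smooth invariants $G_1,\dots,G_\ell:\mathbb R^m\to\mathbb R$, i.e. $\nabla G_j(q)^T R(t,q)=0$ for all $t\in[0,T]$, $q\in\mathbb R^m$ and $j=1,\dots,\ell$. Consider an explicit $s$-stage Runge–Kutta method of order $p\ge 2$. For a state $(t_n,q^n)$ with $t_n\in[0,T)$ and a step size $\Delta t>0$ let $$q^{n+1}=q^n+\Delta t\sum_{j=1}^s b_jR_j,\qquad R_i=R\Big(t_n+c_i\Delta t,\;q^n+\Delta t\sum_{j<i}a_{ij}R_j\Big),\qquad c_i=\sum_{j}a_{ij},$$ let $\mathcal S=\operatorname{span}(R_1,\dots,R_s)$, and let $\nabla G_{j,s}$ denote the orthogonal projection of $\nabla G_j(q^{n+1})$ onto $\mathcal S$. (A one-step scheme has order at least $p$ at $(t_n,q^n)$ if its result after one step of size $\Delta t$ from $(t_n,q^n)$ differs from $q(t_n+\Delta t)$ by $O(\Delta t^{p+1})$ as $\Delta t\to0^+$, where $q$ is the exact solution with $q(t_n)=q^n$. A Runge–Kutta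 method has order $p$ if this holds for every smooth ODE system and every state.) Suppose that, for all sufficiently small $\Delta t>0$, there are unit vectors $\Phi^{(1)},\dots,\Phi^{(\ell)}\in\mathcal S$, depending on $\Delta t$ (for example the search directions of a directional projection method, which are normalized linear combinations of the $R_j$), such that the limit $$M(\Phi^{(1)},\dots,\Phi^{(\ell)})=\lim_{\Delta t\to0^+}\Big[\nabla G_i(q^{n+1})^T\Phi^{(j)}\Big]_{i,j=1}^{\ell}$$ exists and is a nonsingular matrix. Then there are $h^*>0$ and $\rho>0$ such that: 1. for every $\Delta t\in(0,h^*]$ the vectors $\nabla G_{1,s},\dots,\nabla G_{\ell,s}$ are all nonzero, and the quasi-orthogonal projection equations $$\hat q^{\,n+1}=q^{n+1}+\sum_{j=1}^{\ell}\lambda_n^{(j)}\frac{\nabla G_{j,s}}{\|\nabla G_{j,s}\|_2},\qquad G_i(\hat q^{\,n+1})=G_i(q^n)\quad(i=1,\dots,\ell)$$ have a solution $\lambda_n\in\mathbb R^\ell$ with $\max_j|\lambda_n^{(j)}|\le\rho$; 2. for every choice, for each $\Delta t\in(0,h^*]$, of a solution $\lambda_n=\lambda_n(\Delta t)$ with $\max_j|\lambda_n^{(j)}|\le\rho$,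 the projected scheme $\hat q^{\,n+1}$ has order at least $p$ at $(t_n,q^n)$. -/

import Mathlib

open Filter Topology Asymptotics
open scoped ContDiff

noncomputable section

namespace QuasiOrth

/-- The state space `ℝ^m` with its Euclidean inner product and norm. -/
abbrev State (m : ℕ) := EuclideanSpace ℝ (Fin m)

/-- `u` solves `u' = R(τ, u)` on `[t, t + δ]` with `u(t) = q`
(one-sided derivatives at the end points). -/
def IsSolution {m : ℕ} (R : ℝ → State m → State m) (t : ℝ) (q : State m) (δ : ℝ)
    (u : ℝ → State m) : Prop :=
  u t = q ∧
    ∀ τ ∈ Set.Icc t (t + δ), HasDerivWithinAt u (R τ (u τ)) (Set.Icc t (t + δ)) τ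

/-- `G` is a smooth invariant of `q' = R(t, q)` for times in `[0, T]`:
`∇G(q)ᵀ R(t, q) = 0`. -/
def IsInvariant {m : ℕ} (R : ℝ → State m → State m) (T : ℝ) (G : State m → ℝ) : Prop :=
  ContDiff ℝ ∞ G ∧
    ∀ t ∈ Set.Icc (0 : ℝ) T, ∀ q : State m, inner ℝ (gradient G q) (R t q) = 0

/-- Order of accuracy at least `p` at the state `(t, q)`: the result `step h` of one step of size
`h` from `(t, q)` differs from the exact solution through `(t, q)` by `O(h^(p+1))`, `h → 0+`. -/
def OrderAt {m : ℕ} (R : ℝ → State m → State m) (t : ℝ) (q : State m)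
    (step : ℝ → State m) (p : ℕ) : Prop :=
  ∀ (δ : ℝ) (u : ℝ → State m), 0 < δ → IsSolution R t q δ u →
    (fun h : ℝ => step h - u (t + h)) =O[𝓝[>] 0] (fun h : ℝ => h ^ (p + 1))

/-- The coefficients of an explicit Runge–Kutta method with `s` stages. -/
structure ExplicitRK (s : ℕ) where
  /-- the coefficients `a_{ij}` -/
  a : Fin s → Fin s → ℝ
  /-- the weights `b_j` -/
  b : Fin s → ℝ
  explicit : ∀ i j, i ≤ j → a i j = 0

namespace ExplicitRK

/-- The abscissae `c_i = ∑_j a_{ij}`. -/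
def c {s : ℕ} (rk : ExplicitRK s) (i : Fin s) : ℝ := ∑ j, rk.a i j

/-- The stage derivatives `R_i` of a step of size `h` from `(t, q)`. -/
def stage {s m : ℕ} (rk : ExplicitRK s) (R : ℝ → State m → State m) (t : ℝ) (q : State m)
    (h : ℝ) (i : Fin s) : State m :=
  R (t + rk.c i * h)
    (q + h • ∑ j : Fin s, if _hj : j < i then rk.a i j • stage rk R t q h j else 0)
termination_by i.val
decreasing_by exact _hj

/-- The stage derivatives satisfy the usual stage equations. -/
theorem stage_eq {s m : ℕ} (rk : ExplicitRK s) (R : ℝ → State m → State m) (t : ℝ) (q : State m)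
    (h : ℝ) (i : Fin s) :
    rk.stage R t q h i =
      R (t + rk.c i * h) (q + h • ∑ j : Fin s, rk.a i j • rk.stage R t q h j) := by
  rw [stage]
  congr 3
  refine Finset.sum_congr rfl fun j _ => ?_
  by_cases hj : j < i
  · simp [hj]
  · simp [hj, rk.explicit i j (not_lt.mp hj)]

/-- The Runge–Kutta update `q^{n+1} = q + h ∑_j b_j R_j`. -/
def step {s m : ℕ} (rk : ExplicitRK s) (R : ℝ → State m → State m) (t : ℝ) (q : State m)
    (h : ℝ) : State m :=
  q + h • ∑ j : Fin s, rk.b j • rk.stage R t q h j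

/-- The method has order (at least) `p`: its local error is `O(h^(p+1))` for every smooth ODE
system and every initial state. -/
def HasOrder {s : ℕ} (rk : ExplicitRK s) (p : ℕ) : Prop :=
  ∀ (m : ℕ) (R : ℝ → State m → State m),
    ContDiff ℝ ∞ (fun x : ℝ × State m => R x.1 x.2) →
    ∀ (t : ℝ) (q : State m), OrderAt R t q (rk.step R t q) p

/-- The span `𝒮` of the stage derivatives. -/
def stageSpan {s m : ℕ} (rk : ExplicitRK s) (R : ℝ → State m → State m) (t : ℝ) (q : State m)
    (h : ℝ) : Submodule ℝ (State m) :=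
  Submodule.span ℝ (Set.range (rk.stage R t q h))

/-- `∇G_s`: the orthogonal projection of `∇G(q^{n+1})` onto `𝒮`. -/
def gradS {s m : ℕ} (rk : ExplicitRK s) (R : ℝ → State m → State m) (G : State m → ℝ)
    (t : ℝ) (q : State m) (h : ℝ) : State m :=
  (rk.stageSpan R t q h).starProjection (gradient G (rk.step R t q h))

/-- The matrix `[∇G_i(q^{n+1})ᵀ d_j]`. -/
def dirMatrix {s m l : ℕ} (rk : ExplicitRK s) (R : ℝ → State m → State m)
    (G : Fin l → State m → ℝ) (t : ℝ) (q : State m) (h : ℝ) (d : Fin l → State m) :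
    Matrix (Fin l) (Fin l) ℝ :=
  Matrix.of fun i j => inner ℝ (gradient (G i) (rk.step R t q h)) (d j)

/-- The point `q^{n+1} + ∑_j λ_j ∇G_{j,s} / ‖∇G_{j,s}‖`. -/
def qoPoint {s m l : ℕ} (rk : ExplicitRK s) (R : ℝ → State m → State m)
    (G : Fin l → State m → ℝ) (t : ℝ) (q : State m) (h : ℝ) (lam : Fin l → ℝ) : State m :=
  rk.step R t q h +
    ∑ j : Fin l, lam j • (‖rk.gradS R (G j) t q h‖⁻¹ • rk.gradS R (G j) t q h)

/-- `λ` solves the projection equations `G_i(q̂^{n+1}) = G_i(q^n)`, `i = 1, …, l`. -/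
def SolvesQO {s m l : ℕ} (rk : ExplicitRK s) (R : ℝ → State m → State m)
    (G : Fin l → State m → ℝ) (t : ℝ) (q : State m) (h : ℝ) (lam : Fin l → ℝ) : Prop :=
  ∀ i : Fin l, G i (rk.qoPoint R G t q h lam) = G i q

end ExplicitRK

end QuasiOrth

end

/-!
The exact solution conserves every `G i`, so the residual `G i q - G i (q^{n+1})` is `O(h^(p+1))`,
and the correction of `q^{n+1}` has the same size as soon as `λ ↦ (G i (q̂^{n+1}))ᵢ` is invertible
near `0` with constants independent of `h`.

Its derivative at `0` is `λ ↦ (⟨∇G i, w⟩)ᵢ` with `w = ∑ⱼ λⱼ P ∇G j / ‖P ∇G j‖`, `P` the orthogonal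
projection onto `𝒮`. Pairing `w = ∑ⱼ μⱼ P ∇G j` with the `Φ^(k) ∈ 𝒮` gives the `k`-th entry of
`μᵀ [⟨∇G i, Φ^(k)⟩]`, so nonsingularity of the limit `M` bounds `‖μ‖` by `‖w‖`, uniformly in `h`.
The Gram identity `‖w‖² = ∑ᵢ μᵢ ⟨∇G i, w⟩` then bounds `‖μ‖`, hence `‖λ‖`, by the derivative. The
quantitative inverse function theorem yields solvability on a ball of radius `ρ` independent of
`h`, and `‖λ‖ = O(residual)` for every solution in it.
-/

namespace QuasiOrth

open scoped NNReal Matrix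

section LinearAlgebra

variable {ι : Type*} {E : Type*} [NormedAddCommGroup E] [InnerProductSpace ℝ E]

/-- The linear map `w ↦ (⟨g i, w⟩)ᵢ`, i.e. the derivative of a family of functions whose gradients
are the vectors `g i`. -/
noncomputable def innerPi (g : ι → E) : E →L[ℝ] ι → ℝ :=
  ContinuousLinearMap.pi fun i => innerSL ℝ (g i)

theorem innerPi_apply (g : ι → E) (w : E) (i : ι) : innerPi g w i = inner ℝ (g i) w :=
  rfl

variable [Fintype ι]

open scoped Matrix.Norms.Operator in
theorem exists_eventually_antilipschitzWith_vecMul {𝕜 α : Type*} [NormedField 𝕜]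
    [DecidableEq ι] {f : Filter α} {D : α → Matrix ι ι 𝕜} {M : Matrix ι ι 𝕜}
    (hD : Tendsto D f (𝓝 M)) (hM : M.det ≠ 0) :
    ∃ K : ℝ≥0, ∀ᶠ a in f, AntilipschitzWith K fun μ : ι → 𝕜 => μ ᵥ* D a := by
  have hdet : ∀ᶠ a in f, (D a).det ≠ 0 :=
    ((continuous_id.matrix_det.tendsto M).comp hD).eventually_ne hM
  have hinv : Tendsto (fun a => ‖(D a)⁻¹ᵀ‖₊) f (𝓝 ‖M⁻¹ᵀ‖₊) := by
    have hcont : ContinuousAt Ring.inverse M.det := by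
      rw [Ring.inverse_eq_inv']
      exact continuousAt_inv₀ hM
    exact ((continuous_id.matrix_transpose.tendsto _).comp
      ((continuousAt_matrix_inv M hcont).tendsto.comp hD)).nnnorm
  refine ⟨‖M⁻¹ᵀ‖₊ + 1, ?_⟩
  filter_upwards [hdet, hinv.eventually_le_const (lt_add_one _)] with a ha hnorm
  refine AddMonoidHomClass.antilipschitz_of_bound (D a).vecMulLinear fun μ => ?_
  have hμ : (D a)⁻¹ᵀ *ᵥ (μ ᵥ* D a) = μ := by
    rw [Matrix.mulVec_transpose, Matrix.vecMul_vecMul, Matrix.mul_nonsing_inv _ ha.isUnit,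
      Matrix.vecMul_one]
  calc ‖μ‖ = ‖(D a)⁻¹ᵀ *ᵥ (μ ᵥ* D a)‖ := by rw [hμ]
    _ ≤ ‖(D a)⁻¹ᵀ‖ * ‖μ ᵥ* D a‖ := Matrix.linfty_opNorm_mulVec _ _
    _ ≤ (‖M⁻¹ᵀ‖₊ + 1 : ℝ≥0) * ‖μ ᵥ* D a‖ := by gcongr; exact_mod_cast hnorm

theorem abs_dotProduct_le_card_mul_norm_mul_norm (v w : ι → ℝ) :
    |v ⬝ᵥ w| ≤ Fintype.card ι * ‖v‖ * ‖w‖ := by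
  calc |v ⬝ᵥ w| ≤ ∑ i, |v i * w i| := Finset.abs_sum_le_sum_abs _ _
    _ ≤ ∑ _i : ι, ‖v‖ * ‖w‖ := by
        gcongr with i
        exact norm_mul_le_of_le (norm_le_pi_norm v i) (norm_le_pi_norm w i)
    _ = Fintype.card ι * ‖v‖ * ‖w‖ := by simp [mul_assoc]

variable (S : Submodule ℝ E) [S.HasOrthogonalProjection]

/-- The displacement `λ ↦ ∑ⱼ λⱼ P gⱼ / ‖P gⱼ‖`, `P` the orthogonal projection onto `S`, of a
quasi-orthogonal projection step with gradients `g`, as a linear map of the multipliers `λ`. A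
vanishing `P gⱼ` contributes `0`. -/
noncomputable def displacement (g : ι → E) : (ι → ℝ) →L[ℝ] E :=
  (Fintype.linearCombination ℝ fun j =>
    NormedSpace.normalize (S.starProjection (g j))).toContinuousLinearMap

theorem displacement_apply (g : ι → E) (lam : ι → ℝ) :
    displacement S g lam = ∑ j, lam j • NormedSpace.normalize (S.starProjection (g j)) := by
  simp [displacement, Fintype.linearCombination_apply]

theorem displacement_eq_linearCombination_starProjection (g : ι → E) (lam : ι → ℝ) :
    displacement S g lam = Fintype.linearCombination ℝ (fun j => S.starProjection (g j))
      fun j => lam j * ‖S.starProjection (g j)‖⁻¹ := by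
  simp [displacement_apply, Fintype.linearCombination_apply, NormedSpace.normalize, smul_smul]

theorem norm_displacement_le (g : ι → E) : ‖displacement S g‖ ≤ Fintype.card ι := by
  refine ContinuousLinearMap.opNorm_le_bound _ (by positivity) fun lam => ?_
  calc ‖displacement S g lam‖
      ≤ ∑ j, ‖lam j • NormedSpace.normalize (S.starProjection (g j))‖ := by
        rw [displacement_apply]
        exact norm_sum_le _ _
    _ ≤ ∑ _j : ι, ‖lam‖ * 1 := by
        gcongr with j
        rw [norm_smul]
        gcongr
        · exact norm_le_pi_norm lam j
        · rw [NormedSpace.normalize, norm_smul, norm_inv, norm_norm]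
          exact inv_mul_le_one
    _ = Fintype.card ι * ‖lam‖ := by simp

variable {S}

theorem inner_linearCombination_starProjection (g : ι → E) (μ : ι → ℝ) {w : E} (hw : w ∈ S) :
    inner ℝ (Fintype.linearCombination ℝ (fun j => S.starProjection (g j)) μ) w =
      μ ⬝ᵥ innerPi g w := by
  simp only [Fintype.linearCombination_apply, sum_inner, real_inner_smul_left, dotProduct,
    innerPi_apply, S.inner_starProjection_left_eq_right,
    Submodule.starProjection_eq_self_iff.mpr hw]

theorem antilipschitzWith_linearCombination_starProjection {κ : Type*} [Fintype κ] {g : ι → E}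
    {d : κ → E} (hdS : ∀ k, d k ∈ S) (hd : ∀ k, ‖d k‖ ≤ 1) {K : ℝ≥0}
    (hK : AntilipschitzWith K
      fun μ : ι → ℝ => μ ᵥ* Matrix.of fun i k => inner ℝ (g i) (d k)) :
    AntilipschitzWith K (Fintype.linearCombination ℝ fun j => S.starProjection (g j)) := by
  refine AddMonoidHomClass.antilipschitz_of_bound _ fun μ => ?_
  set w := Fintype.linearCombination ℝ (fun j => S.starProjection (g j)) μ
  have hpair : ∀ k, (μ ᵥ* Matrix.of fun i k => inner ℝ (g i) (d k)) k = inner ℝ w (d k) :=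
    fun k => (inner_linearCombination_starProjection g μ (hdS k)).symm
  refine (ZeroHomClass.bound_of_antilipschitz (Matrix.vecMulLinear _) hK μ).trans ?_
  gcongr
  refine (pi_norm_le_iff_of_nonneg (norm_nonneg w)).mpr fun k => ?_
  calc _ = |inner ℝ w (d k)| := congrArg abs (hpair k)
    _ ≤ ‖w‖ * ‖d k‖ := abs_real_inner_le_norm _ _
    _ ≤ ‖w‖ := mul_le_of_le_one_right (norm_nonneg w) (hd k)

theorem ne_zero_of_antilipschitzWith_linearCombination {v : ι → E} {K : ℝ≥0}
    (hK : AntilipschitzWith K (Fintype.linearCombination ℝ v)) (j : ι) : v j ≠ 0 :=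
  (linearIndependent_iff_injective_fintypeLinearCombination.mpr hK.injective).ne_zero j

/-- With `w = ∑ⱼ μⱼ P gⱼ`, the Gram identity `‖w‖² = ∑ᵢ μᵢ ⟨gᵢ, w⟩` turns `‖μ‖ ≤ K ‖w‖` into a lower
bound on `(⟨gᵢ, w⟩)ᵢ`. -/
theorem norm_le_mul_norm_innerPi_linearCombination {g : ι → E} {K : ℝ≥0}
    (hK : AntilipschitzWith K (Fintype.linearCombination ℝ fun j => S.starProjection (g j)))
    (μ : ι → ℝ) :
    ‖μ‖ ≤ K ^ 2 * Fintype.card ι *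
      ‖innerPi g (Fintype.linearCombination ℝ (fun j => S.starProjection (g j)) μ)‖ := by
  set w := Fintype.linearCombination ℝ (fun j => S.starProjection (g j)) μ
  have hwS : w ∈ S := S.sum_mem fun j _ => S.smul_mem _ (S.starProjection_apply_mem (g j))
  have hμw : ‖μ‖ ≤ K * ‖w‖ := ZeroHomClass.bound_of_antilipschitz _ hK μ
  have hgram : ‖w‖ ^ 2 = μ ⬝ᵥ innerPi g w := by
    rw [← real_inner_self_eq_norm_sq, ← inner_linearCombination_starProjection g μ hwS]
  have hsq : ‖μ‖ * ‖μ‖ ≤ ‖μ‖ * (K ^ 2 * Fintype.card ι * ‖innerPi g w‖) := by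
    calc ‖μ‖ * ‖μ‖ ≤ (K * ‖w‖) * (K * ‖w‖) := by gcongr
      _ = K ^ 2 * (μ ⬝ᵥ innerPi g w) := by rw [← hgram]; ring
      _ ≤ K ^ 2 * (Fintype.card ι * ‖μ‖ * ‖innerPi g w‖) := by
          gcongr
          exact (le_abs_self _).trans (abs_dotProduct_le_card_mul_norm_mul_norm _ _)
      _ = ‖μ‖ * (K ^ 2 * Fintype.card ι * ‖innerPi g w‖) := by ring
  rcases (norm_nonneg μ).eq_or_lt with h0 | hpos
  · rw [← h0]
    positivity
  · exact le_of_mul_le_mul_left hsq hpos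

theorem antilipschitzWith_innerPi_comp_displacement {g : ι → E} {C K : ℝ≥0}
    (hC : ∀ j, ‖g j‖ ≤ C)
    (hK : AntilipschitzWith K (Fintype.linearCombination ℝ fun j => S.starProjection (g j))) :
    AntilipschitzWith (C * (K ^ 2 * Fintype.card ι)) (innerPi g ∘L displacement S g) := by
  refine ContinuousLinearMap.antilipschitz_of_bound _ fun lam => ?_
  set μ : ι → ℝ := fun j => lam j * ‖S.starProjection (g j)‖⁻¹ with hμ
  have hlam : ‖lam‖ ≤ C * ‖μ‖ := by
    refine (pi_norm_le_iff_of_nonneg (by positivity)).mpr fun j => ?_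
    have hj : ‖S.starProjection (g j)‖ ≠ 0 :=
      norm_ne_zero_iff.mpr (ne_zero_of_antilipschitzWith_linearCombination hK j)
    calc ‖lam j‖ = ‖S.starProjection (g j)‖ * ‖μ j‖ := by
          rw [hμ, norm_mul, norm_inv, norm_norm]
          field_simp
      _ ≤ C * ‖μ‖ := by
          gcongr
          · exact (S.norm_starProjection_apply_le _).trans (hC j)
          · exact norm_le_pi_norm μ j
  rw [ContinuousLinearMap.comp_apply, displacement_eq_linearCombination_starProjection]
  calc ‖lam‖ ≤ C * ‖μ‖ := hlam
    _ ≤ C * (K ^ 2 * Fintype.card ι * ‖innerPi g _‖) := by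
        gcongr
        exact norm_le_mul_norm_innerPi_linearCombination hK μ
    _ = _ := by push_cast; ring

end LinearAlgebra

section InverseFunction

variable {𝕜 : Type*} [NontriviallyNormedField 𝕜]
  {V : Type*} [NormedAddCommGroup V] [NormedSpace 𝕜 V]
  {W : Type*} [NormedAddCommGroup W] [NormedSpace 𝕜 W]
  {f : V → W} {A : V →L[𝕜] W} {s : Set V} {c K : ℝ≥0}

theorem antilipschitzWith_domRestrict_of_approximatesLinearOn (hf : ApproximatesLinearOn f A s c)
    (hA : AntilipschitzWith K A) (hc : c < K⁻¹) :
    AntilipschitzWith (K⁻¹ - c)⁻¹ (s.domRestrict f) := by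
  convert! (hA.domRestrict s).add_lipschitzWith hf.lipschitz_sub hc
  simp [Set.domRestrict]

theorem surjOn_closedBall_of_approximatesLinearOn [CompleteSpace 𝕜] [FiniteDimensional 𝕜 V]
    {f : V → V} {A : V →L[𝕜] V} (hf : ApproximatesLinearOn f A s c)
    (hA : AntilipschitzWith K A) {v : V} {ρ : ℝ} (hρ : 0 ≤ ρ) (hs : Metric.closedBall v ρ ⊆ s) :
    Set.SurjOn f (Metric.closedBall v ρ) (Metric.closedBall (f v) (((K : ℝ)⁻¹ - c) * ρ)) := by
  have : CompleteSpace V := FiniteDimensional.complete 𝕜 V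
  have hsurj : Function.Surjective A :=
    (A : V →ₗ[𝕜] V).injective_iff_surjective.mp hA.injective
  obtain ⟨B, hB⟩ := hsurj.hasRightInverse
  let rightInverse : A.NonlinearRightInverse :=
    { toFun := B
      nnnorm := K
      bound' := fun y => by simpa [hB y] using A.bound_of_antilipschitz hA (B y)
      right_inv' := hB }
  exact hf.surjOn_closedBall_of_nonlinearRightInverse rightInverse hρ hs

end InverseFunction

section UniformInverseFunction

variable {α 𝕜 : Type*} {f : Filter α} [RCLike 𝕜]
  {E : Type*} [NormedAddCommGroup E] [NormedSpace 𝕜 E]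
  {F : Type*} [NormedAddCommGroup F] [NormedSpace 𝕜 F]
  {V : Type*} [NormedAddCommGroup V] [NormedSpace 𝕜 V]

theorem exists_mem_nhds_approximatesLinearOn_fderiv {Γ : E → F} {q : E} (hΓ : ContDiffAt 𝕜 1 Γ q)
    {c : ℝ≥0} (hc : 0 < c) :
    ∃ U ∈ 𝓝 q, ∀ z ∈ U, ApproximatesLinearOn Γ (fderiv 𝕜 Γ z) U c := by
  have hc2 : 0 < c / 2 := half_pos hc
  have hstrict : HasStrictFDerivAt Γ (fderiv 𝕜 Γ q) q := hΓ.hasStrictFDerivAt one_ne_zero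
  obtain ⟨U, hU, hUapprox⟩ := hstrict.approximates_deriv_on_nhds (.inr hc2)
  have hnear : ∀ᶠ z in 𝓝 q, ‖fderiv 𝕜 Γ q - fderiv 𝕜 Γ z‖₊ < c / 2 := by
    have hcont : ContinuousAt (fderiv 𝕜 Γ) q :=
      (hΓ.fderiv_right (m := 0) (by simp)).continuousAt
    have hlim := (continuousAt_const (y := fderiv 𝕜 Γ q)).sub hcont |>.nnnorm
    exact hlim.eventually_lt_const (by simpa using hc2)
  refine ⟨_, inter_mem hU hnear, fun z hz x hx y hy => ?_⟩
  have hsplit : Γ x - Γ y - fderiv 𝕜 Γ z (x - y) = (Γ x - Γ y - fderiv 𝕜 Γ q (x - y)) +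
      (fderiv 𝕜 Γ q - fderiv 𝕜 Γ z) (x - y) := by
    rw [sub_apply]
    abel
  have hz2 : ‖fderiv 𝕜 Γ q - fderiv 𝕜 Γ z‖ ≤ (c / 2 : ℝ≥0) := hz.2.le
  calc _ ≤ ‖Γ x - Γ y - fderiv 𝕜 Γ q (x - y)‖ + ‖(fderiv 𝕜 Γ q - fderiv 𝕜 Γ z) (x - y)‖ := by
        rw [hsplit]
        exact norm_add_le _ _
    _ ≤ (c / 2 : ℝ≥0) * ‖x - y‖ + (c / 2 : ℝ≥0) * ‖x - y‖ := by
        gcongr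
        · exact hUapprox x hx.1 y hy.1
        · exact ContinuousLinearMap.le_of_opNorm_le _ hz2 _
    _ = c * ‖x - y‖ := by push_cast; ring

theorem approximatesLinearOn_comp_const_add {Γ : E → F} {A : E →L[𝕜] F} {U : Set E} {c L : ℝ≥0}
    (hΓ : ApproximatesLinearOn Γ A U c) {D : V →L[𝕜] E} (hD : ‖D‖ ≤ L) {x : E} {s : Set V}
    (hs : Set.MapsTo (fun v => x + D v) s U) :
    ApproximatesLinearOn (fun v => Γ (x + D v)) (A ∘L D) s (c * L) := by
  intro v hv w hw
  have h := hΓ _ (hs hv) _ (hs hw)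
  rw [add_sub_add_left_eq_sub, ← map_sub] at h
  calc _ ≤ c * ‖D (v - w)‖ := h
    _ ≤ c * (L * ‖v - w‖) := by gcongr; exact D.le_of_opNorm_le hD _
    _ = _ := by push_cast; ring

theorem exists_eventually_approximatesLinearOn_comp {Γ : E → F} {q : E}
    (hΓ : ContDiffAt 𝕜 1 Γ q) {x : α → E} (hx : Tendsto x f (𝓝 q)) {D : α → V →L[𝕜] E} {L : ℝ≥0}
    (hD : ∀ a, ‖D a‖ ≤ L) {c : ℝ≥0} (hc : 0 < c) :
    ∃ ρ > 0, ∀ᶠ a in f, ApproximatesLinearOn (fun v => Γ (x a + D a v))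
      (fderiv 𝕜 Γ (x a) ∘L D a) (Metric.closedBall 0 ρ) c := by
  have hL : 0 < L + 1 := by positivity
  obtain ⟨U, hU, hUapprox⟩ := exists_mem_nhds_approximatesLinearOn_fderiv hΓ (div_pos hc hL)
  obtain ⟨r, hr, hrU⟩ := Metric.mem_nhds_iff.mp hU
  refine ⟨r / (2 * (L + 1)), by positivity, ?_⟩
  filter_upwards [hx.eventually (Metric.ball_mem_nhds q (half_pos hr))] with a hxa
  have hxU : x a ∈ U := hrU (Metric.ball_subset_ball (half_le_self hr.le) hxa)
  have hDa : ‖D a‖ ≤ (L + 1 : ℝ≥0) := (hD a).trans (by simp)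
  have hmaps : Set.MapsTo (fun v => x a + D a v) (Metric.closedBall 0 (r / (2 * (L + 1)))) U := by
    intro v hv
    have hDv : ‖D a v‖ ≤ r / 2 := by
      calc ‖D a v‖ ≤ (L + 1 : ℝ≥0) * (r / (2 * (L + 1))) :=
            (D a).le_of_opNorm_le_of_le hDa (mem_closedBall_zero_iff.mp hv)
        _ = r / 2 := by push_cast; field_simp
    apply hrU
    rw [dist_eq_norm] at hxa
    rw [mem_ball_iff_norm]
    calc ‖x a + D a v - q‖ ≤ ‖x a - q‖ + ‖D a v‖ := by
          rw [add_sub_right_comm]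
          exact norm_add_le _ _
      _ < r := by linarith
  have h := approximatesLinearOn_comp_const_add (hUapprox _ hxU) hDa hmaps
  rwa [div_mul_cancel₀ _ hL.ne'] at h

theorem exists_eventually_solvable_and_norm_le [FiniteDimensional 𝕜 V] {Γ : E → V} {q : E}
    (hΓ : ContDiffAt 𝕜 1 Γ q) {x : α → E} (hx : Tendsto x f (𝓝 q)) {D : α → V →L[𝕜] E} {L : ℝ≥0}
    (hD : ∀ a, ‖D a‖ ≤ L) {K : ℝ≥0} (hK : 0 < K)
    (hA : ∀ᶠ a in f, AntilipschitzWith K (fderiv 𝕜 Γ (x a) ∘L D a)) :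
    ∃ ρ > 0, ∀ᶠ a in f, (∃ v, ‖v‖ ≤ ρ ∧ Γ (x a + D a v) = Γ q) ∧
      ∀ v, ‖v‖ ≤ ρ → ‖v‖ ≤ 2 * K * ‖Γ (x a + D a v) - Γ (x a)‖ := by
  have hc : K⁻¹ / 2 < K⁻¹ := half_lt_self (inv_pos.mpr hK)
  obtain ⟨ρ, hρ, happrox⟩ :=
    exists_eventually_approximatesLinearOn_comp hΓ hx hD (half_pos (inv_pos.mpr hK))
  have hradius : 0 < ((K : ℝ)⁻¹ - (K⁻¹ / 2 : ℝ≥0)) * ρ :=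
    mul_pos (sub_pos.mpr (by exact_mod_cast hc)) hρ
  have hnear : ∀ᶠ a in f, dist (Γ q) (Γ (x a)) ≤ ((K : ℝ)⁻¹ - (K⁻¹ / 2 : ℝ≥0)) * ρ := by
    have hlim := (tendsto_const_nhds (x := Γ q)).dist (hΓ.continuousAt.tendsto.comp hx)
    exact hlim.eventually_le_const (by simpa using hradius)
  refine ⟨ρ, hρ, ?_⟩
  filter_upwards [hA, happrox, hnear] with a hAa hFa hqa
  constructor
  · have hsurj := surjOn_closedBall_of_approximatesLinearOn hFa hAa hρ.le subset_rfl
    obtain ⟨v, hv, hvq⟩ := hsurj (show Γ q ∈ _ by simpa using hqa)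
    exact ⟨v, mem_closedBall_zero_iff.mp hv, hvq⟩
  · intro v hv
    have hanti := antilipschitzWith_domRestrict_of_approximatesLinearOn hFa hAa hc
    have h := hanti.le_mul_dist ⟨v, mem_closedBall_zero_iff.mpr hv⟩
      ⟨0, Metric.mem_closedBall_self hρ.le⟩
    have hconst : (K⁻¹ - K⁻¹ / 2)⁻¹ = 2 * K := by
      rw [tsub_eq_of_eq_add (add_halves _).symm, inv_div, div_inv_eq_mul]
    simpa [hconst, Subtype.dist_eq, dist_eq_norm] using h

end UniformInverseFunction

section Gradient

variable {E : Type*} [NormedAddCommGroup E] [InnerProductSpace ℝ E] [CompleteSpace E] {q : E}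

theorem continuousAt_gradient {G : E → ℝ} (hG : ContDiffAt ℝ 1 G q) :
    ContinuousAt (gradient G) q :=
  (InnerProductSpace.toDual ℝ E).symm.continuous.continuousAt.comp
    (hG.fderiv_right (m := 0) (by simp)).continuousAt

theorem fderiv_pi_eq_innerPi_gradient {ι : Type*} {G : ι → E → ℝ}
    (hG : ∀ i, DifferentiableAt ℝ (G i) q) :
    fderiv ℝ (fun y i => G i y) q = innerPi fun i => gradient (G i) q := by
  ext w i
  rw [fderiv_pi hG, ContinuousLinearMap.pi_apply, innerPi_apply, inner_gradient_left]

end Gradient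

section QuasiOrthogonalProjection

variable {α ι : Type*} [Fintype ι] {f : Filter α}
  {E : Type*} [NormedAddCommGroup E] [InnerProductSpace ℝ E]
  {S : α → Submodule ℝ E} [∀ a, (S a).HasOrthogonalProjection]

theorem exists_eventually_antilipschitzWith_innerPi_comp_displacement [DecidableEq ι]
    {g d : α → ι → E} {g₀ : ι → E} (hg : Tendsto g f (𝓝 g₀))
    (hd : ∀ᶠ a in f, ∀ j, d a j ∈ S a ∧ ‖d a j‖ ≤ 1) {M : Matrix ι ι ℝ}
    (hM : Tendsto (fun a => Matrix.of fun i j => inner ℝ (g a i) (d a j)) f (𝓝 M))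
    (hdet : M.det ≠ 0) :
    ∃ K > 0, ∀ᶠ a in f, (∀ j, (S a).starProjection (g a j) ≠ 0) ∧
      AntilipschitzWith K (innerPi (g a) ∘L displacement (S a) (g a)) := by
  obtain ⟨K, hK⟩ := exists_eventually_antilipschitzWith_vecMul hM hdet
  have hbound : ∀ᶠ a in f, ‖g a‖₊ ≤ ‖g₀‖₊ + 1 :=
    hg.nnnorm.eventually_le_const (lt_add_one _)
  refine ⟨(‖g₀‖₊ + 1) * (K ^ 2 * Fintype.card ι) + 1, by positivity, ?_⟩
  filter_upwards [hd, hK, hbound] with a hda hKa hga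
  have hproj := antilipschitzWith_linearCombination_starProjection (fun j => (hda j).1)
    (fun j => (hda j).2) hKa
  have hJ := antilipschitzWith_innerPi_comp_displacement (C := ‖g₀‖₊ + 1)
    (fun j => (norm_le_pi_norm (g a) j).trans (by exact_mod_cast hga)) hproj
  refine ⟨ne_zero_of_antilipschitzWith_linearCombination hproj, fun v w => (hJ v w).trans ?_⟩
  gcongr
  exact le_self_add

theorem exists_eventually_quasiOrthogonal_projection [CompleteSpace E] [DecidableEq ι]
    {G : ι → E → ℝ} {q : E}
    (hG : ∀ i, ContDiffAt ℝ 1 (G i) q) {x : α → E} (hx : Tendsto x f (𝓝 q))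
    {d : α → ι → E} (hd : ∀ᶠ a in f, ∀ j, d a j ∈ S a ∧ ‖d a j‖ ≤ 1) {M : Matrix ι ι ℝ}
    (hM : Tendsto (fun a => Matrix.of fun i j => inner ℝ (gradient (G i) (x a)) (d a j)) f (𝓝 M))
    (hdet : M.det ≠ 0) :
    let disp := fun a => displacement (S a) fun j => gradient (G j) (x a)
    ∃ ρ > 0, ∃ C, ∀ᶠ a in f,
      (∀ j, (S a).starProjection (gradient (G j) (x a)) ≠ 0) ∧
      (∃ lam : ι → ℝ, ‖lam‖ ≤ ρ ∧ ∀ i, G i (x a + disp a lam) = G i q) ∧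
      ∀ lam : ι → ℝ, ‖lam‖ ≤ ρ → (∀ i, G i (x a + disp a lam) = G i q) →
        ‖disp a lam‖ ≤ C * ‖fun i => G i q - G i (x a)‖ := by
  intro disp
  have hgrad : Tendsto (fun a j => gradient (G j) (x a)) f (𝓝 fun j => gradient (G j) q) :=
    tendsto_pi_nhds.mpr fun j => (continuousAt_gradient (hG j)).tendsto.comp hx
  obtain ⟨K, hK, hKJ⟩ :=
    exists_eventually_antilipschitzWith_innerPi_comp_displacement hgrad hd hM hdet
  have hdiff : ∀ᶠ a in f, ∀ i, DifferentiableAt ℝ (G i) (x a) :=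
    eventually_all.mpr fun i => hx.eventually <|
      ((hG i).eventually (by simp)).mono fun y hy => hy.differentiableAt one_ne_zero
  have hdisp : ∀ a, ‖disp a‖ ≤ (Fintype.card ι : ℝ≥0) := fun a => norm_displacement_le _ _
  have hJ : ∀ᶠ a in f, AntilipschitzWith K (fderiv ℝ (fun y i => G i y) (x a) ∘L disp a) := by
    filter_upwards [hKJ, hdiff] with a ha hdiffa
    rw [fderiv_pi_eq_innerPi_gradient hdiffa]
    exact ha.2
  obtain ⟨ρ, hρ, hsolve⟩ :=
    exists_eventually_solvable_and_norm_le (contDiffAt_pi.mpr hG) hx hdisp hK hJ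
  refine ⟨ρ, hρ, Fintype.card ι * (2 * K), ?_⟩
  filter_upwards [hKJ, hsolve] with a hKa ⟨⟨lam₀, hlam₀, heq₀⟩, hbound⟩
  refine ⟨hKa.1, ⟨lam₀, hlam₀, congrFun heq₀⟩, fun lam hlam heq => ?_⟩
  have hsol : (fun i => G i (x a + disp a lam)) = fun i => G i q := funext heq
  have hlam_le := hbound lam hlam
  rw [hsol] at hlam_le
  calc ‖disp a lam‖ ≤ Fintype.card ι * ‖lam‖ := (disp a).le_of_opNorm_le (hdisp a) lam
    _ ≤ Fintype.card ι * (2 * K * ‖fun i => G i q - G i (x a)‖) := by gcongr; exact hlam_le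
    _ = _ := by ring

end QuasiOrthogonalProjection

section ExactSolution

variable {m : ℕ} {R : ℝ → State m → State m} {t δ : ℝ} {q : State m} {u : ℝ → State m}

theorem IsSolution.mono (hu : IsSolution R t q δ u) {ε : ℝ} (hε : ε ≤ δ) :
    IsSolution R t q ε u := by
  have hsub : Set.Icc t (t + ε) ⊆ Set.Icc t (t + δ) := Set.Icc_subset_Icc_right (by linarith)
  exact ⟨hu.1, fun τ hτ => (hu.2 τ (hsub hτ)).mono hsub⟩

theorem IsSolution.tendsto (hu : IsSolution R t q δ u) (hδ : 0 < δ) :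
    Tendsto (fun h => u (t + h)) (𝓝[>] 0) (𝓝 q) := by
  have hcont : Tendsto u (𝓝[Set.Icc t (t + δ)] t) (𝓝 q) := by
    simpa only [ContinuousWithinAt, hu.1] using
      (hu.2 t ⟨le_rfl, by linarith⟩).continuousWithinAt
  refine hcont.comp (tendsto_nhdsWithin_iff.mpr ⟨?_, ?_⟩)
  · have hadd : Tendsto (t + ·) (𝓝 0) (𝓝 t) := by
      simpa using (continuous_const_add t).tendsto 0
    exact hadd.mono_left nhdsWithin_le_nhds
  · filter_upwards [Ioc_mem_nhdsGT hδ] with h hh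
    exact ⟨by linarith [hh.1], by linarith [hh.2]⟩

theorem IsSolution.eq_of_inner_gradient_eq_zero (hu : IsSolution R t q δ u) {G : State m → ℝ}
    (hG : Differentiable ℝ G)
    (hinv : ∀ τ ∈ Set.Icc t (t + δ), inner ℝ (gradient G (u τ)) (R τ (u τ)) = 0) :
    ∀ τ ∈ Set.Icc t (t + δ), G (u τ) = G q := by
  have hderiv : ∀ τ ∈ Set.Icc t (t + δ),
      HasDerivWithinAt (G ∘ u) 0 (Set.Icc t (t + δ)) τ := by
    intro τ hτ
    rw [← hinv τ hτ, inner_gradient_left]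
    exact (hG (u τ)).hasFDerivAt.comp_hasDerivWithinAt τ (hu.2 τ hτ)
  have hconst := constant_of_has_deriv_right_zero
    (fun τ hτ => (hderiv τ hτ).continuousWithinAt)
    fun τ hτ => (hderiv τ ⟨hτ.1, hτ.2.le⟩).mono_of_mem_nhdsWithin (Icc_mem_nhdsGE_of_mem hτ)
  simpa [hu.1] using hconst

variable {l p : ℕ} {G : Fin l → State m → ℝ} {step step' : ℝ → State m}

/-- As the `G i` are constant along the exact solution, `G i q - G i (step h)` has the size of the
error of `step`. -/
theorem OrderAt.of_sub_isBigO_invariants (hstep : OrderAt R t q step p)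
    (hlim : Tendsto step (𝓝[>] 0) (𝓝 q)) (hG : ∀ i, ContDiff ℝ 1 (G i)) {T : ℝ} (hT : t < T)
    (hinv : ∀ i, ∀ τ ∈ Set.Icc t T, ∀ y, inner ℝ (gradient (G i) y) (R τ y) = 0)
    (hstep' : (fun h => step' h - step h) =O[𝓝[>] 0] fun h i => G i q - G i (step h)) :
    OrderAt R t q step' p := by
  intro δ u hδ hu
  have herr := hstep δ u hδ hu
  set ε := min δ (T - t)
  have hε : 0 < ε := lt_min hδ (sub_pos.mpr hT)
  have hεT : t + ε ≤ T := by linarith [min_le_right δ (T - t)]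
  have hconst : ∀ h ∈ Set.Ioc 0 ε, ∀ i, G i (u (t + h)) = G i q := fun h hh i =>
    (hu.mono (min_le_left _ _)).eq_of_inner_gradient_eq_zero ((hG i).differentiable one_ne_zero)
      (fun τ hτ => hinv i τ ⟨hτ.1, hτ.2.trans hεT⟩ (u τ)) _
      ⟨by linarith [hh.1], by linarith [hh.2]⟩
  have hres : (fun h i => G i q - G i (step h)) =O[𝓝[>] 0] fun h => step h - u (t + h) := by
    refine isBigO_pi.mpr fun i => ?_
    have hlip := ((hG i).contDiffAt.hasStrictFDerivAt one_ne_zero).isBigO_sub.comp_tendsto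
      (hlim.prodMk_nhds (hu.tendsto hδ))
    refine hlip.neg_left.congr' ?_ EventuallyEq.rfl
    filter_upwards [Ioc_mem_nhdsGT hε] with h hh
    simp [hconst h hh i]
  exact ((hstep'.trans (hres.trans herr)).add herr).congr_left fun h => sub_add_sub_cancel _ _ _

end ExactSolution

namespace ExplicitRK

variable {m s l : ℕ} (rk : ExplicitRK s) {R : ℝ → State m → State m}

theorem continuous_stage (hR : Continuous fun x : ℝ × State m => R x.1 x.2) (t : ℝ)
    (q : State m) (i : Fin s) : Continuous fun h => rk.stage R t q h i := by
  induction i using WellFoundedLT.induction with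
  | ind i ih =>
    have hterm : ∀ j, Continuous fun h => rk.a i j • rk.stage R t q h j := fun j => by
      rcases lt_or_ge j i with hj | hj
      · exact (ih j hj).const_smul (rk.a i j)
      · simpa only [rk.explicit i j hj, zero_smul] using continuous_const
    simp only [rk.stage_eq R t q _ i]
    exact hR.comp (.prodMk (by fun_prop) (by fun_prop))

theorem tendsto_step (hR : Continuous fun x : ℝ × State m => R x.1 x.2) (t : ℝ) (q : State m) :
    Tendsto (rk.step R t q) (𝓝[>] 0) (𝓝 q) := by
  have hstage := rk.continuous_stage hR t q
  have hcont : Continuous (rk.step R t q) := by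
    unfold step
    fun_prop
  simpa [step] using (hcont.tendsto 0).mono_left nhdsWithin_le_nhds

theorem qoPoint_eq_step_add_displacement (R : ℝ → State m → State m) (G : Fin l → State m → ℝ)
    (t : ℝ) (q : State m) (h : ℝ) (lam : Fin l → ℝ) :
    rk.qoPoint R G t q h lam = rk.step R t q h +
      displacement (rk.stageSpan R t q h) (fun j => gradient (G j) (rk.step R t q h)) lam := by
  rw [displacement_apply]
  rfl

end ExplicitRK

end QuasiOrth

theorem mainTheorem5_general {m s l p : ℕ}
    (R : ℝ → QuasiOrth.State m → QuasiOrth.State m)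
    (hR : Continuous fun x : ℝ × QuasiOrth.State m => R x.1 x.2)
    (t T : ℝ) (ht : t < T) (G : Fin l → QuasiOrth.State m → ℝ)
    (hG : ∀ j, ContDiff ℝ 1 (G j))
    (hinv : ∀ j, ∀ τ ∈ Set.Icc t T, ∀ y, inner ℝ (gradient (G j) y) (R τ y) = 0)
    (q : QuasiOrth.State m)
    (rk : QuasiOrth.ExplicitRK s) (hrk : QuasiOrth.OrderAt R t q (rk.step R t q) p)
    (Φ : Fin l → ℝ → QuasiOrth.State m)
    (hΦ : ∀ᶠ h in 𝓝[>] (0 : ℝ), ∀ j, Φ j h ∈ rk.stageSpan R t q h ∧ ‖Φ j h‖ ≤ 1)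
    (M : Matrix (Fin l) (Fin l) ℝ)
    (hM : Tendsto (fun h : ℝ => rk.dirMatrix R G t q h (fun j => Φ j h)) (𝓝[>] 0) (𝓝 M))
    (hdet : M.det ≠ 0) :
    ∃ hstar > (0 : ℝ), ∃ ρ > (0 : ℝ),
      (∀ h ∈ Set.Ioc 0 hstar,
        (∀ j, rk.gradS R (G j) t q h ≠ 0) ∧
        ∃ lam : Fin l → ℝ, ‖lam‖ ≤ ρ ∧ rk.SolvesQO R G t q h lam) ∧
      ∀ lam : ℝ → Fin l → ℝ,
        (∀ h ∈ Set.Ioc 0 hstar, ‖lam h‖ ≤ ρ ∧ rk.SolvesQO R G t q h (lam h)) →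
        QuasiOrth.OrderAt R t q (fun h => rk.qoPoint R G t q h (lam h)) p := by
  have hlim := rk.tendsto_step hR t q
  obtain ⟨ρ, hρ, C, hev⟩ := QuasiOrth.exists_eventually_quasiOrthogonal_projection
    (fun j => (hG j).contDiffAt) hlim hΦ hM hdet
  obtain ⟨hstar, hpos, hsub⟩ := mem_nhdsGT_iff_exists_Ioc_subset.mp hev
  simp only [QuasiOrth.ExplicitRK.SolvesQO, rk.qoPoint_eq_step_add_displacement]
  refine ⟨hstar, hpos, ρ, hρ, fun h hh => ⟨(hsub hh).1, (hsub hh).2.1⟩, fun lam hlam => ?_⟩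
  refine hrk.of_sub_isBigO_invariants hlim hG ht hinv (.of_bound C ?_)
  filter_upwards [Ioc_mem_nhdsGT hpos] with h hh
  rw [add_sub_cancel_left]
  exact (hsub hh).2.2 (lam h) (hlam h hh).1 (hlam h hh).2

theorem mainTheorem5 {m s l p : ℕ} (hp : 2 ≤ p)
    (R : ℝ → QuasiOrth.State m → QuasiOrth.State m)
    (hR : ContDiff ℝ ∞ (fun x : ℝ × QuasiOrth.State m => R x.1 x.2))
    (T : ℝ) (G : Fin l → QuasiOrth.State m → ℝ)
    (hG : ∀ j, QuasiOrth.IsInvariant R T (G j))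
    (rk : QuasiOrth.ExplicitRK s) (hrk : rk.HasOrder p)
    (t : ℝ) (ht : t ∈ Set.Ico 0 T) (q : QuasiOrth.State m)
    (Φ : Fin l → ℝ → QuasiOrth.State m)
    (hΦ : ∀ᶠ h in 𝓝[>] (0 : ℝ), ∀ j, Φ j h ∈ rk.stageSpan R t q h ∧ ‖Φ j h‖ = 1)
    (M : Matrix (Fin l) (Fin l) ℝ)
    (hM : Tendsto (fun h : ℝ => rk.dirMatrix R G t q h (fun j => Φ j h)) (𝓝[>] 0) (𝓝 M))
    (hdet : M.det ≠ 0) :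
    ∃ hstar > (0 : ℝ), ∃ ρ > (0 : ℝ),
      (∀ h ∈ Set.Ioc 0 hstar,
        (∀ j, rk.gradS R (G j) t q h ≠ 0) ∧
        ∃ lam : Fin l → ℝ, ‖lam‖ ≤ ρ ∧ rk.SolvesQO R G t q h lam) ∧
      ∀ lam : ℝ → Fin l → ℝ,
        (∀ h ∈ Set.Ioc 0 hstar, ‖lam h‖ ≤ ρ ∧ rk.SolvesQO R G t q h (lam h)) →
        QuasiOrth.OrderAt R t q (fun h => rk.qoPoint R G t q h (lam h)) p := by
  exact mainTheorem5_general R hR.continuous t T ht.2 G (fun j => (hG j).1.of_le (by simp))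
    (fun j τ hτ => (hG j).2 τ ⟨ht.1.trans hτ.1, hτ.2⟩) q rk (hrk m R hR t q) Φ
    (hΦ.mono fun h hh j => ⟨(hh j).1, (hh j).2.le⟩) M hM hdet
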